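/- **Setting.** For every $n$ let $d=d(n)$ be a dimension and let $\sigma_X[1],\dots,\sigma_X[d]>0$ and $\sigma_Z[1],\dots,\sigma_Z[d]>0$ (all depending on $n$). Put $\Sigma_X=\mathrm{diag}(\sigma_X^2[1],\dots,\sigma_X^2[d])$ and $\Sigma_Z=\mathrm{diag}(\sigma_Z^2[1],\dots,\sigma_Z^2[d])$. For a real random variable $U$ let $\|U\|_{\psi_2}=\inf\{L>0:\ \mathbb E\exp(U^2/L^2)\le 2\}$. Let $K_X,K_Z>0$ be constants not depending on $n$. **Model HD** consists of the following assumptions, as $n\to\infty$: * $d=\omega(\log n)$; * $\tilde X_1,\dots,\tilde X_n$ are i.i.d. random vectors in $\mathbb R^d$, $\tilde Z_1,\dots,\tilde Z_n$ are i.i.d. random vectors in $\mathbb R^d$, and the two families are independent of each other; * the coordinates of $\tilde X_1$ are independent, and so are the coordinates of $\tilde Z_1$; for all $j$, $\mathbb E\tilde X_1[j]=\mathbb E\tilde Z_1[j]=0$, $\operatorname{Var}(\tilde X_1[j])=1$, $\|\tilde X_1[j]\|_{\psi_2}\le K_X$ and $\|\tilde Z_1[j]\|_{\psi_2}\le K_Z$;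 * $X_i=\Sigma_X^{1/2}\tilde X_i$ and $Z_i=\Sigma_Z^{1/2}\tilde Z_i$; * $\pi^\star$ is uniformly distributed on the symmetric group $S_n$ and independent of $(\tilde X_i)_i,(\tilde Z_i)_i$, and the observed points are $Y_i=X_{\pi^\star(i)}+Z_i$, $1\le i\le n$. The least sum of squares estimator is any map $\hat\pi_{\mathrm{LSS}}=\hat\pi_{\mathrm{LSS}}(X_1,\dots,X_n,Y_1,\dots,Y_n)\in\arg\min_{\pi\in S_n}\sum_{j=1}^n\|X_{\pi(j)}-Y_j\|_2^2$ (ties broken in any way), and $d_H(\hat\pi,\pi^\star)=\#\{j:\hat\pi(j)\ne\pi^\star(j)\}$ is its number of mistakes. An event $A_n$ holds with high probability if $\mathbb P(A_n)=1-o(1)$. **Theorem 1.4 (perfect recovery for LSS in high dimensions).** There exists an absolute constant $b_{\mathrm{HD}}>0$ such that the following holds. Under Model HD, suppose $$\frac{\operatorname{tr}(\Sigma_Z\Sigma_X)}{\|\Sigma_Z\Sigma_X\|_{\mathrm{op}}}=\omega(\log n),\qquad \frac{\operatorname{tr}(\Sigma_X)}{\|\Sigma_X\|_{\mathrm{op}}}=\omega(\log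 n),$$ and let $\tilde\sigma_X^2[j]=\sigma_X^2[j]/\sum_{k=1}^d\sigma_X^2[k]$. If, for all sufficiently large $n$, $$b_{\mathrm{HD}}\,K_Z^2\ \le\ \frac{1}{\log n}\cdot\frac{\sum_{j=1}^d\sigma_X^2[j]}{\sum_{j=1}^d\tilde\sigma_X^2[j]\,\sigma_Z^2[j]},$$ then $d_H(\hat\pi_{\mathrm{LSS}},\pi^\star)=0$ with high probability. -/

import Mathlib

open MeasureTheory ProbabilityTheory Filter Asymptotics
open scoped ENNReal NNReal Topology

/-- The sub-Gaussian norm `‖U‖_{ψ₂} = inf {L > 0 : E[exp(U² / L²)] ≤ 2}` of a real random variable,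
with values in `[0, ∞]` (it is `∞` exactly when no such `L` exists). -/
noncomputable def subGaussianNorm {Ω : Type*} [MeasurableSpace Ω] (μ : Measure Ω) (U : Ω → ℝ) :
    ℝ≥0∞ :=
  ⨅ (L : ℝ≥0) (_ : 0 < L)
    (_ : ∫⁻ ω, ENNReal.ofReal (Real.exp (U ω ^ 2 / (L : ℝ) ^ 2)) ∂μ ≤ 2), (L : ℝ≥0∞)

/-- The covariance matrix `Σ = diag(σ[1]², …, σ[d]²)` attached to standard deviations `σ`. -/
def covMatrix {d : ℕ} (σ : Fin d → ℝ) : Matrix (Fin d) (Fin d) ℝ :=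
  Matrix.diagonal fun j => σ j ^ 2

/-- The square root `Σ^{1/2} = diag(σ[1], …, σ[d])` of `covMatrix σ`, for nonnegative `σ`. -/
def covSqrt {d : ℕ} (σ : Fin d → ℝ) : Matrix (Fin d) (Fin d) ℝ :=
  Matrix.diagonal σ

theorem covSqrt_mul_self {d : ℕ} (σ : Fin d → ℝ) : covSqrt σ * covSqrt σ = covMatrix σ := by
  simp [covSqrt, covMatrix, Matrix.diagonal_mul_diagonal, sq]

/-- The stable rank `tr(A) / ‖A‖_op`, where `‖A‖_op` is the operator norm of `A` for the
Euclidean norm. -/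
noncomputable def stableRank {d : ℕ} (A : Matrix (Fin d) (Fin d) ℝ) : ℝ :=
  A.trace / ‖Matrix.toEuclideanCLM (𝕜 := ℝ) (n := Fin d) A‖

/-- The weights `σ̃²[j] = σ²[j] / ∑ₖ σ²[k]`. -/
noncomputable def normalizedVar {d : ℕ} (σ : Fin d → ℝ) (j : Fin d) : ℝ :=
  σ j ^ 2 / ∑ k, σ k ^ 2

/-- The points `v_i = Σ^{1/2} ṽ_i`. -/
noncomputable def scaledPoints {n d : ℕ} (σ : Fin d → ℝ)
    (v : Fin n → EuclideanSpace ℝ (Fin d)) : Fin n → EuclideanSpace ℝ (Fin d) :=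
  fun i => WithLp.toLp 2 (Matrix.mulVec (covSqrt σ) (v i).ofLp)

/-- The observed points `Y_i = X_{π(i)} + Z_i`. -/
noncomputable def observedPoints {n d : ℕ} (π : Equiv.Perm (Fin n))
    (X Z : Fin n → EuclideanSpace ℝ (Fin d)) : Fin n → EuclideanSpace ℝ (Fin d) :=
  fun i => X (π i) + Z i

/-- `est` is a least sum of squares estimator: a map sending two sequences of `n` points to a
permutation that minimises `∑ⱼ ‖X_{π(j)} - Y_j‖²` over `π ∈ Sₙ` (ties may be broken in any way). -/
def IsLSS {n d : ℕ}
    (est : (Fin n → EuclideanSpace ℝ (Fin d)) → (Fin n → EuclideanSpace ℝ (Fin d)) →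
      Equiv.Perm (Fin n)) : Prop :=
  ∀ (X Y : Fin n → EuclideanSpace ℝ (Fin d)) (π : Equiv.Perm (Fin n)),
    ∑ j, ‖X (est X Y j) - Y j‖ ^ 2 ≤ ∑ j, ‖X (π j) - Y j‖ ^ 2

/-- The finite set `Sₙ` carries the discrete σ-algebra. -/
instance permMeasurableSpace (n : ℕ) : MeasurableSpace (Equiv.Perm (Fin n)) := ⊤

/-- A family of random vectors `V_1, …, V_n` in `ℝ^d` that is i.i.d., each vector having
independent centred coordinates of sub-Gaussian norm at most `K`. -/
structure IsIIDSubGaussian {Ω : Type*} [MeasurableSpace Ω] (μ : Measure Ω) {n d : ℕ}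
    (V : Fin n → Ω → EuclideanSpace ℝ (Fin d)) (K : ℝ) : Prop where
  measurable : ∀ i, Measurable (V i)
  indep : iIndepFun V μ
  identDistrib : ∀ i i', IdentDistrib (V i) (V i') μ μ
  indep_coord : ∀ i, iIndepFun (fun (j : Fin d) (ω : Ω) => V i ω j) μ
  mean_zero : ∀ i j, ∫ ω, V i ω j ∂μ = 0
  subGaussian : ∀ i j, subGaussianNorm μ (fun ω => V i ω j) ≤ ENNReal.ofReal K

/-- The high-dimensional model with `n` points in `ℝ^d`: `Xt` and `Zt` are the standardised
positions and perturbations, `σX` and `σZ` the coordinatewise scales, `πstar` the hidden matching,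
`KX` and `KZ` the bounds on the sub-Gaussian norms. -/
structure ModelHD {Ω : Type*} [MeasurableSpace Ω] (μ : Measure Ω) {n d : ℕ}
    (σX σZ : Fin d → ℝ) (Xt Zt : Fin n → Ω → EuclideanSpace ℝ (Fin d))
    (πstar : Ω → Equiv.Perm (Fin n)) (KX KZ : ℝ) : Prop where
  σX_pos : ∀ j, 0 < σX j
  σZ_pos : ∀ j, 0 < σZ j
  positions : IsIIDSubGaussian μ Xt KX
  perturbations : IsIIDSubGaussian μ Zt KZ
  /-- The coordinates of the standardised positions have unit variance, so that `covMatrix σX` is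
  the covariance matrix of the positions. -/
  unit_variance : ∀ i j, Var[fun ω => Xt i ω j; μ] = 1
  indep_positions_perturbations : IndepFun (fun ω i => Xt i ω) (fun ω i => Zt i ω) μ
  /-- `πstar` is uniformly distributed over `Sₙ`. -/
  uniform_perm : HasLaw πstar (uniformOn Set.univ) μ
  indep_perm : IndepFun πstar (fun ω => ((fun i => Xt i ω), (fun i => Zt i ω))) μ

/-- The events `A n` hold with high probability: `P(A n) = 1 - o(1)`. It is phrased as
`P((A n)ᶜ) = o(1)`, which for measurable events is the same and for other sets is stronger. -/
def WithHighProbability {Ω : ℕ → Type*} [∀ n, MeasurableSpace (Ω n)] (μ : ∀ n, Measure (Ω n))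
    (A : ∀ n, Set (Ω n)) : Prop :=
  Tendsto (fun n => μ n (A n)ᶜ) atTop (𝓝 0)

/-! Put `Δ = X_i - X_{i'}`. If `2⟨Δ, Z_j⟩ < ‖Δ‖²` for all `i ≠ i'` and all `j`, every reassignment
strictly increases the cost, so the estimator is exact (`IsLSS.eq_of_forall_lt`). It remains to
bound the failure probability for one triple and to sum over at most `n³` triples.

Let `T = ∑ σX²` and `A = ∑ σZ² σX²`. The standardised difference has independent coordinates of
second moment 2, so `‖Δ‖²` has mean `2T`, and `∑ σZ² Δ²`, which governs the conditional variance of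
`⟨Δ, Z_j⟩`, has mean `2A`. Each is a weighted sum of independent subexponential variables. By
Chernoff, `‖Δ‖² ≤ T` or `∑ σZ² Δ² ≥ 3A` occurs with probability exponentially small in the
corresponding stable rank, hence smaller than any fixed power of `n`
(`measure_le_sum_mul_sq_le_exp`).

Off these events, given `Δ`, the form `⟨Δ, Z_j⟩` is sub-Gaussian and reaches `‖Δ‖²/2` with
probability at most `exp(-T²/(192 KZ² A))` (`measure_sum_sq_le_two_mul_sum_le_exp`). The
signal-to-noise hypothesis is a lower bound on `T²/(KZ² A log n)`. With constant 768 each of the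
three events has probability at most `n⁻⁴`, for a total of `3/n`. -/

/-! ### Elementary inequalities for the exponential -/

/-- The linear term integrates to zero against a centred variable, leaving only an exponential of
the square. -/
theorem Real.exp_le_add_exp_sq (x : ℝ) : Real.exp x ≤ x + Real.exp (x ^ 2) := by
  have h2 := Real.add_one_le_exp (x ^ 2)
  by_cases h : |x| ≤ 1
  · have h1 := (abs_le.1 (Real.abs_exp_sub_one_sub_id_le h)).2
    linarith
  · rcases lt_abs.1 (not_le.1 h) with h | h
    · have : Real.exp x ≤ Real.exp (x ^ 2) := Real.exp_le_exp.2 (by nlinarith)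
      linarith
    · have : Real.exp x ≤ 1 := Real.exp_le_one_iff.2 (by linarith)
      nlinarith

/-- Keeps the first-order term exact, so that applied to `t * U ^ 2` it retains the true mean. -/
theorem Real.exp_le_one_add_add_sq_mul_exp_abs (x : ℝ) :
    Real.exp x ≤ 1 + x + x ^ 2 * Real.exp |x| := by
  have h2 : 1 ≤ Real.exp |x| := Real.one_le_exp (abs_nonneg x)
  by_cases h : |x| ≤ 1
  · have h1 := (abs_le.1 (Real.abs_exp_sub_one_sub_id_le h)).2
    nlinarith [sq_nonneg x]
  · rcases lt_abs.1 (not_le.1 h) with h | h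
    · rw [abs_of_pos (by linarith)] at *
      nlinarith [mul_nonneg (show 0 ≤ x ^ 2 - 1 by nlinarith) (Real.exp_pos x).le]
    · have : Real.exp x ≤ 1 := Real.exp_le_one_iff.2 (by linarith)
      nlinarith [sq_nonneg x]

/-- Convexity of the exponential, along a segment issued from `0`. -/
theorem Real.exp_mul_le_one_add_mul {p y : ℝ} (hp : 0 ≤ p) (hp1 : p ≤ 1) :
    Real.exp (p * y) ≤ 1 + p * (Real.exp y - 1) := by
  have := convexOn_exp.2 (Set.mem_univ 0) (Set.mem_univ y) (sub_nonneg.2 hp1) hp (by ring)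
  simp only [smul_eq_mul, mul_zero, zero_add, Real.exp_zero, mul_one] at this
  linarith

/-! ### Moment generating functions and the Chernoff bound -/

section

variable {Ω : Type*} [MeasurableSpace Ω] {μ : Measure Ω}

theorem integrable_of_lintegral_ofReal_le {f : Ω → ℝ} {c : ℝ} (hf : Measurable f)
    (h0 : ∀ ω, 0 ≤ f ω) (hc : 0 ≤ c) (h : ∫⁻ ω, ENNReal.ofReal (f ω) ∂μ ≤ ENNReal.ofReal c) :
    Integrable f μ ∧ ∫ ω, f ω ∂μ ≤ c := by
  have hi : Integrable f μ := by
    refine ⟨hf.aestronglyMeasurable, ?_⟩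
    rw [hasFiniteIntegral_iff_ofReal (ae_of_all _ h0)]
    exact h.trans_lt ENNReal.ofReal_lt_top
  refine ⟨hi, ?_⟩
  rw [← ofReal_integral_eq_lintegral_ofReal hi (ae_of_all _ h0)] at h
  exact (ENNReal.ofReal_le_ofReal_iff hc).1 h

theorem lintegral_ofReal_exp_le_of_le {f g : Ω → ℝ} {c : ℝ} (hg : Integrable g μ)
    (hfg : ∀ ω, Real.exp (f ω) ≤ g ω) (hc : ∫ ω, g ω ∂μ ≤ c) :
    ∫⁻ ω, ENNReal.ofReal (Real.exp (f ω)) ∂μ ≤ ENNReal.ofReal c := by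
  calc ∫⁻ ω, ENNReal.ofReal (Real.exp (f ω)) ∂μ ≤ ∫⁻ ω, ENNReal.ofReal (g ω) ∂μ :=
        lintegral_mono fun ω => ENNReal.ofReal_le_ofReal (hfg ω)
    _ = ENNReal.ofReal (∫ ω, g ω ∂μ) :=
        (ofReal_integral_eq_lintegral_ofReal hg
          (ae_of_all _ fun ω => (Real.exp_pos _).le.trans (hfg ω))).symm
    _ ≤ ENNReal.ofReal c := ENNReal.ofReal_le_ofReal hc

/-- Asking for `K < L` strictly avoids showing that the infimum is attained: some admissible `M`
lies below `L`, and the integral decreases in the scale. It is applied later with `L = 2K`. -/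
theorem lintegral_exp_sq_div_le_of_subGaussianNorm_le {U : Ω → ℝ} {K L : ℝ} (hK : 0 < K)
    (hKL : K < L) (h : subGaussianNorm μ U ≤ ENNReal.ofReal K) :
    ∫⁻ ω, ENNReal.ofReal (Real.exp (U ω ^ 2 / L ^ 2)) ∂μ ≤ 2 := by
  have hlt : subGaussianNorm μ U < ENNReal.ofReal L :=
    h.trans_lt ((ENNReal.ofReal_lt_ofReal_iff (hK.trans hKL)).2 hKL)
  simp only [subGaussianNorm, iInf_lt_iff] at hlt
  obtain ⟨M, hM, hint, hML⟩ := hlt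
  have hML' : (M : ℝ) ≤ L := by
    rw [ENNReal.ofReal, ENNReal.coe_lt_coe] at hML
    have := NNReal.coe_lt_coe.2 hML
    rw [Real.coe_toNNReal _ (hK.trans hKL).le] at this
    exact this.le
  refine le_trans (lintegral_mono fun ω => ENNReal.ofReal_le_ofReal (Real.exp_le_exp.2 ?_)) hint
  have : (0 : ℝ) < M := hM
  gcongr

/-- A centred random variable with `E[exp(U² / L²)] ≤ 2` satisfies `E[exp(s U)] ≤ exp(L² s²)`. -/
theorem lintegral_exp_mul_le_of_mean_zero [IsProbabilityMeasure μ] {U : Ω → ℝ} {L : ℝ}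
    (hU : Measurable U) (hL : 0 < L) (h0 : ∫ ω, U ω ∂μ = 0)
    (h : ∫⁻ ω, ENNReal.ofReal (Real.exp (U ω ^ 2 / L ^ 2)) ∂μ ≤ 2) (s : ℝ) :
    ∫⁻ ω, ENNReal.ofReal (Real.exp (s * U ω)) ∂μ ≤ ENNReal.ofReal (Real.exp (L ^ 2 * s ^ 2)) := by
  obtain ⟨hi, hle⟩ := integrable_of_lintegral_ofReal_le (μ := μ)
    (f := fun ω => Real.exp (U ω ^ 2 / L ^ 2)) (c := 2) (by fun_prop)
    (fun ω => (Real.exp_pos _).le) (by norm_num) (by simpa using h)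
  set G : Ω → ℝ := fun ω => Real.exp (U ω ^ 2 / L ^ 2) with hG
  have hUi : Integrable U μ := by
    refine (hi.const_mul L).mono' hU.aestronglyMeasurable (ae_of_all _ fun ω => ?_)
    have h1 := Real.add_one_le_exp (U ω ^ 2 / L ^ 2)
    rw [Real.norm_eq_abs]
    have h2 : |U ω| ≤ L * (U ω ^ 2 / L ^ 2 + 1) := by
      rw [show L * (U ω ^ 2 / L ^ 2 + 1) = (|U ω| ^ 2 + L ^ 2) / L by
        rw [sq_abs]; field_simp, le_div_iff₀ hL]
      nlinarith [sq_nonneg (|U ω| - L), abs_nonneg (U ω)]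
    exact h2.trans (mul_le_mul_of_nonneg_left h1 hL.le)
  have hc : ∀ p : ℝ, Integrable (fun ω => 1 + p * (G ω - 1)) μ := fun p =>
    (integrable_const _).add ((hi.sub (integrable_const _)).const_mul _)
  have hcint : ∀ p : ℝ, 0 ≤ p → ∫ ω, (1 + p * (G ω - 1)) ∂μ ≤ 1 + p := fun p hp => by
    have h1 : Integrable (fun ω => G ω - 1) μ := hi.sub (integrable_const _)
    rw [integral_add (integrable_const _) (h1.const_mul p), integral_const_mul,
      integral_sub hi (integrable_const _)]
    simp only [integral_const, probReal_univ, smul_eq_mul, mul_one]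
    nlinarith
  -- For small `s`, convexity with weight `p = L²s²` bounds `E[exp(s²U²)]` by `1 + L²s²`. For large
  -- `s`, `sU ≤ L²s²/2 + U²/(2L²)`, and the second part contributes at most `3/2 ≤ exp(L²s²/2)`.
  by_cases hs : L ^ 2 * s ^ 2 ≤ 1
  · refine lintegral_ofReal_exp_le_of_le
      (g := fun ω => s * U ω + (1 + L ^ 2 * s ^ 2 * (G ω - 1))) ?_ (fun ω => ?_) ?_
    · exact (hUi.const_mul s).add (hc _)
    · refine (Real.exp_le_add_exp_sq _).trans (add_le_add le_rfl ?_)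
      have := Real.exp_mul_le_one_add_mul (y := U ω ^ 2 / L ^ 2) (by positivity) hs
      rwa [show L ^ 2 * s ^ 2 * (U ω ^ 2 / L ^ 2) = (s * U ω) ^ 2 by field_simp] at this
    · rw [integral_add (hUi.const_mul s) (hc _), integral_const_mul, h0]
      have := Real.add_one_le_exp (L ^ 2 * s ^ 2)
      have := hcint (L ^ 2 * s ^ 2) (by positivity)
      linarith
  · refine lintegral_ofReal_exp_le_of_le
      (g := fun ω => Real.exp (L ^ 2 * s ^ 2 / 2) * (1 + 1 / 2 * (G ω - 1))) ?_ (fun ω => ?_) ?_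
    · exact (hc _).const_mul _
    · have := Real.exp_mul_le_one_add_mul (p := 1 / 2) (y := U ω ^ 2 / L ^ 2)
        (by norm_num) (by norm_num)
      refine le_trans ?_ (mul_le_mul_of_nonneg_left this (Real.exp_pos _).le)
      rw [← Real.exp_add, Real.exp_le_exp]
      have h3 := sq_nonneg (L * s - U ω / L)
      have h4 : (L * s - U ω / L) ^ 2 = L ^ 2 * s ^ 2 - 2 * (s * U ω) + U ω ^ 2 / L ^ 2 := by
        field_simp
        ring
      linarith
    · rw [integral_const_mul]
      have h5 := hcint (1 / 2) (by norm_num)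
      have h6 := Real.add_one_le_exp (L ^ 2 * s ^ 2 / 2)
      calc Real.exp (L ^ 2 * s ^ 2 / 2) * ∫ ω, (1 + 1 / 2 * (G ω - 1)) ∂μ
          ≤ Real.exp (L ^ 2 * s ^ 2 / 2) * Real.exp (L ^ 2 * s ^ 2 / 2) := by
            gcongr
            linarith
        _ = Real.exp (L ^ 2 * s ^ 2) := by rw [← Real.exp_add, add_halves]

/-- If `E[U²] = v` and `E[exp(U² / (2 L²))] ≤ 4` then `E[exp(t U²)] ≤ exp(v t + 128 L⁴ t²)` for
small `|t|`. -/
theorem lintegral_exp_mul_sq_le [IsProbabilityMeasure μ] {U : Ω → ℝ} {L v : ℝ}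
    (hU : Measurable U) (hL : 0 < L) (hv : ∫ ω, U ω ^ 2 ∂μ = v)
    (h : ∫⁻ ω, ENNReal.ofReal (Real.exp (U ω ^ 2 / (2 * L ^ 2))) ∂μ ≤ 4) {t : ℝ}
    (ht : 4 * L ^ 2 * |t| ≤ 1) :
    ∫⁻ ω, ENNReal.ofReal (Real.exp (t * U ω ^ 2)) ∂μ ≤
      ENNReal.ofReal (Real.exp (v * t + 128 * L ^ 4 * t ^ 2)) := by
  obtain ⟨hi, hle⟩ := integrable_of_lintegral_ofReal_le (μ := μ)
    (f := fun ω => Real.exp (U ω ^ 2 / (2 * L ^ 2))) (c := 4) (by fun_prop)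
    (fun ω => (Real.exp_pos _).le) (by norm_num) (by simpa using h)
  set G : Ω → ℝ := fun ω => Real.exp (U ω ^ 2 / (2 * L ^ 2)) with hG
  have hUi : Integrable (fun ω => U ω ^ 2) μ := by
    refine (hi.const_mul (2 * L ^ 2)).mono' (by fun_prop) (ae_of_all _ fun ω => ?_)
    have h1 := Real.add_one_le_exp (U ω ^ 2 / (2 * L ^ 2))
    rw [Real.norm_eq_abs, abs_of_nonneg (sq_nonneg _)]
    calc U ω ^ 2 = 2 * L ^ 2 * (U ω ^ 2 / (2 * L ^ 2)) := by field_simp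
      _ ≤ 2 * L ^ 2 * G ω := mul_le_mul_of_nonneg_left (by linarith) (by positivity)
  have h1U : Integrable (fun ω => 1 + t * U ω ^ 2) μ :=
    (integrable_const _).add (hUi.const_mul t)
  refine lintegral_ofReal_exp_le_of_le
    (g := fun ω => 1 + t * U ω ^ 2 + 32 * L ^ 4 * t ^ 2 * G ω) ?_ (fun ω => ?_) ?_
  · exact h1U.add (hi.const_mul _)
  · refine (Real.exp_le_one_add_add_sq_mul_exp_abs _).trans (add_le_add le_rfl ?_)
    -- In this scale `G = exp(2y)`: one factor `exp y` absorbs `exp |tU²|`, the other absorbs `y² ≤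
    -- 2 exp y`. Then `E[G] ≤ 4` turns 32 into 128.
    set y := U ω ^ 2 / (4 * L ^ 2) with hy
    have hy0 : 0 ≤ y := by positivity
    have hUy : U ω ^ 2 = 4 * L ^ 2 * y := by rw [hy]; field_simp
    have h1 : |t * U ω ^ 2| ≤ y := by
      rw [abs_mul, abs_of_nonneg (sq_nonneg (U ω)), hUy]
      nlinarith
    have h2 : y ^ 2 ≤ 2 * Real.exp y := by
      have := Real.quadratic_le_exp_of_nonneg hy0
      nlinarith
    have h3 : G ω = Real.exp y * Real.exp y := by
      rw [← Real.exp_add]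
      change Real.exp (U ω ^ 2 / (2 * L ^ 2)) = _
      congr 1
      rw [hUy]; field_simp; ring
    rw [h3]
    calc (t * U ω ^ 2) ^ 2 * Real.exp |t * U ω ^ 2|
        ≤ (t * U ω ^ 2) ^ 2 * Real.exp y := by gcongr
      _ = 16 * L ^ 4 * t ^ 2 * (y ^ 2 * Real.exp y) := by rw [hUy]; ring
      _ ≤ 16 * L ^ 4 * t ^ 2 * ((2 * Real.exp y) * Real.exp y) := by gcongr
      _ = _ := by ring
  · rw [integral_add h1U (hi.const_mul _),
      integral_add (integrable_const _) (hUi.const_mul t), integral_const_mul, integral_const_mul,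
      hv]
    simp only [integral_const, probReal_univ, smul_eq_mul, mul_one]
    have := Real.add_one_le_exp (v * t + 128 * L ^ 4 * t ^ 2)
    have h5 : 32 * L ^ 4 * t ^ 2 * ∫ ω, G ω ∂μ ≤ 32 * L ^ 4 * t ^ 2 * 4 := by gcongr
    linarith

/-- The Chernoff bound for a sum of independent random variables. -/
theorem measure_le_sum_le_exp {ι : Type*} [Fintype ι] {Y : ι → Ω → ℝ}
    (hY : ∀ i, Measurable (Y i)) (hind : iIndepFun Y μ) {c : ι → ℝ}
    (hc : ∀ i, ∫⁻ ω, ENNReal.ofReal (Real.exp (Y i ω)) ∂μ ≤ ENNReal.ofReal (Real.exp (c i)))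
    (a : ℝ) :
    μ {ω | a ≤ ∑ i, Y i ω} ≤ ENNReal.ofReal (Real.exp (∑ i, c i - a)) := by
  have hm : ∀ i, Measurable fun ω => ENNReal.ofReal (Real.exp (Y i ω)) := fun i => by
    have := hY i; fun_prop
  have hprod : ∫⁻ ω, ENNReal.ofReal (Real.exp (∑ i, Y i ω)) ∂μ ≤
      ENNReal.ofReal (Real.exp (∑ i, c i)) := by
    calc ∫⁻ ω, ENNReal.ofReal (Real.exp (∑ i, Y i ω)) ∂μ
        = ∫⁻ ω, ∏ i, ENNReal.ofReal (Real.exp (Y i ω)) ∂μ := by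
          refine lintegral_congr fun ω => ?_
          rw [Real.exp_sum, ENNReal.ofReal_prod_of_nonneg fun i _ => (Real.exp_pos _).le]
      _ = ∏ i, ∫⁻ ω, ENNReal.ofReal (Real.exp (Y i ω)) ∂μ :=
          lintegral_prod_eq_prod_lintegral_of_indepFun _
            (fun i ω => ENNReal.ofReal (Real.exp (Y i ω)))
            (hind.comp (fun _ x => ENNReal.ofReal (Real.exp x)) fun _ => by fun_prop) hm
      _ ≤ ∏ i, ENNReal.ofReal (Real.exp (c i)) := Finset.prod_le_prod' fun i _ => hc i
      _ = _ := by rw [Real.exp_sum, ENNReal.ofReal_prod_of_nonneg fun i _ => (Real.exp_pos _).le]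
  have hsub : {ω | a ≤ ∑ i, Y i ω} ⊆
      {ω | ENNReal.ofReal (Real.exp a) ≤ ENNReal.ofReal (Real.exp (∑ i, Y i ω))} :=
    fun ω hω => ENNReal.ofReal_le_ofReal (Real.exp_le_exp.2 hω)
  have hmark := mul_meas_ge_le_lintegral (μ := μ)
    (f := fun ω => ENNReal.ofReal (Real.exp (∑ i, Y i ω))) (by fun_prop)
    (ENNReal.ofReal (Real.exp a))
  calc μ {ω | a ≤ ∑ i, Y i ω}
      ≤ μ {ω | ENNReal.ofReal (Real.exp a) ≤ ENNReal.ofReal (Real.exp (∑ i, Y i ω))} :=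
        measure_mono hsub
    _ ≤ ENNReal.ofReal (Real.exp (∑ i, c i)) / ENNReal.ofReal (Real.exp a) := by
        rw [ENNReal.le_div_iff_mul_le (Or.inl (by simp [Real.exp_pos])) (Or.inl (by simp)),
          mul_comm]
        exact hmark.trans hprod
    _ = _ := by rw [← ENNReal.ofReal_div_of_pos (Real.exp_pos _), Real.exp_sub]

end

/-! ### Differences of two independent points -/

section

variable {Ω : Type*} [MeasurableSpace Ω] {μ : Measure Ω}

/-- Two independent families of independent random variables form a family of independent
pairs. -/
theorem iIndepFun_prodMk_of_indepFun {ι : Type*} [Fintype ι] [IsProbabilityMeasure μ]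
    {U V : ι → Ω → ℝ} (hU : ∀ i, Measurable (U i)) (hV : ∀ i, Measurable (V i))
    (hUi : iIndepFun U μ) (hVi : iIndepFun V μ)
    (h : IndepFun (fun ω i => U i ω) (fun ω i => V i ω) μ) :
    iIndepFun (fun i ω => (U i ω, V i ω)) μ := by
  have hUm : Measurable fun ω i => U i ω := measurable_pi_lambda _ hU
  have hVm : Measurable fun ω i => V i ω := measurable_pi_lambda _ hV
  have hpair : ∀ i, Measurable fun ω => (U i ω, V i ω) := fun i => (hU i).prodMk (hV i)
  have hUp : ∀ i, IsProbabilityMeasure (μ.map (U i)) := fun i =>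
    Measure.isProbabilityMeasure_map (hU i).aemeasurable
  have hVp : ∀ i, IsProbabilityMeasure (μ.map (V i)) := fun i =>
    Measure.isProbabilityMeasure_map (hV i).aemeasurable
  have hcoord : ∀ i, μ.map (fun ω => (U i ω, V i ω)) = (μ.map (U i)).prod (μ.map (V i)) :=
    fun i => (indepFun_iff_map_prod_eq_prod_map_map (hU i).aemeasurable (hV i).aemeasurable).1
      (h.comp (measurable_pi_apply i) (measurable_pi_apply i))
  rw [iIndepFun_iff_map_fun_eq_pi_map fun i => (hpair i).aemeasurable]
  simp only [hcoord]
  have hpres := measurePreserving_arrowProdEquivProdArrow ℝ ℝ ι (fun i => μ.map (U i))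
    (fun i => μ.map (V i))
  -- Regrouping a family of pairs as a pair of families turns both sides into the joint law of `U`
  -- and `V`.
  apply (MeasurableEquiv.arrowProdEquivProdArrow ℝ ℝ ι).map_measurableEquiv_injective
  rw [hpres.map_eq, ← iIndepFun.map_fun_eq_pi_map (fun i => (hU i).aemeasurable) hUi,
    ← iIndepFun.map_fun_eq_pi_map (fun i => (hV i).aemeasurable) hVi,
    Measure.map_map (MeasurableEquiv.measurable _) (measurable_pi_lambda _ hpair),
    ← (indepFun_iff_map_prod_eq_prod_map_map hUm.aemeasurable hVm.aemeasurable).1 h]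
  rfl

theorem integral_sub_sq_eq_two [IsProbabilityMeasure μ] {U V : Ω → ℝ} (hU0 : ∫ ω, U ω ∂μ = 0)
    (hV0 : ∫ ω, V ω ∂μ = 0) (hU1 : Var[U; μ] = 1) (hV1 : Var[V; μ] = 1) (hU : Measurable U)
    (hV : Measurable V) (h : IndepFun U V μ) : ∫ ω, (U ω - V ω) ^ 2 ∂μ = 2 := by
  -- Variance defaults to 0 outside `L²`, so the value 1 forces square integrability.
  have key : ∀ W : Ω → ℝ, Measurable W → Var[W; μ] = 1 → MemLp W 2 μ := fun W hW h1 => by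
    by_contra hn
    have := variance_of_not_memLp hW.aestronglyMeasurable hn
    linarith
  have hU2 := key U hU hU1
  have hV2 := key V hV hV1
  rw [variance_of_integral_eq_zero hU.aemeasurable hU0] at hU1
  rw [variance_of_integral_eq_zero hV.aemeasurable hV0] at hV1
  have hUi := hU2.integrable (by norm_num)
  have hVi := hV2.integrable (by norm_num)
  have hUV : Integrable (fun ω => U ω * V ω) μ := h.integrable_mul hUi hVi
  have hUV0 : ∫ ω, U ω * V ω ∂μ = 0 := by
    rw [h.integral_fun_mul_eq_mul_integral hUi.aestronglyMeasurable hVi.aestronglyMeasurable,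
      hU0, zero_mul]
  have hsum : Integrable (fun ω => U ω ^ 2 + V ω ^ 2) μ := hU2.integrable_sq.add hV2.integrable_sq
  calc ∫ ω, (U ω - V ω) ^ 2 ∂μ = ∫ ω, ((U ω ^ 2 + V ω ^ 2) - 2 * (U ω * V ω)) ∂μ := by
        congr 1; ext ω; ring
    _ = 2 := by
        rw [integral_sub hsum (hUV.const_mul 2),
          integral_add hU2.integrable_sq hV2.integrable_sq, integral_const_mul, hUV0, hU1, hV1]
        norm_num

/-- Since `(u - v)² ≤ 2u² + 2v²`, the exponential is dominated by a product of two independent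
factors. -/
theorem lintegral_exp_sub_sq_le {U V : Ω → ℝ} {L : ℝ} (hL : 0 < L) (hU : Measurable U)
    (hV : Measurable V) (h : IndepFun U V μ)
    (hUL : ∫⁻ ω, ENNReal.ofReal (Real.exp (U ω ^ 2 / L ^ 2)) ∂μ ≤ 2)
    (hVL : ∫⁻ ω, ENNReal.ofReal (Real.exp (V ω ^ 2 / L ^ 2)) ∂μ ≤ 2) :
    ∫⁻ ω, ENNReal.ofReal (Real.exp ((U ω - V ω) ^ 2 / (2 * L ^ 2))) ∂μ ≤ 4 := by
  have hm : Measurable fun x : ℝ => ENNReal.ofReal (Real.exp (x ^ 2 / L ^ 2)) := by fun_prop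
  calc ∫⁻ ω, ENNReal.ofReal (Real.exp ((U ω - V ω) ^ 2 / (2 * L ^ 2))) ∂μ
      ≤ ∫⁻ ω, ENNReal.ofReal (Real.exp (U ω ^ 2 / L ^ 2)) *
          ENNReal.ofReal (Real.exp (V ω ^ 2 / L ^ 2)) ∂μ := by
        refine lintegral_mono fun ω => ?_
        rw [← ENNReal.ofReal_mul (Real.exp_pos _).le, ← Real.exp_add]
        refine ENNReal.ofReal_le_ofReal (Real.exp_le_exp.2 ?_)
        rw [← add_div, div_le_div_iff₀ (by positivity) (by positivity)]
        nlinarith [mul_nonneg (sq_nonneg L) (sq_nonneg (U ω + V ω))]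
    _ = (∫⁻ ω, ENNReal.ofReal (Real.exp (U ω ^ 2 / L ^ 2)) ∂μ) *
          ∫⁻ ω, ENNReal.ofReal (Real.exp (V ω ^ 2 / L ^ 2)) ∂μ :=
        lintegral_mul_eq_lintegral_mul_lintegral_of_indepFun'' (hm.comp hU).aemeasurable
          (hm.comp hV).aemeasurable (h.comp hm hm)
    _ ≤ 2 * 2 := mul_le_mul' hUL hVL
    _ = 4 := by norm_num

/-! ### Two-sided concentration of weighted sums of squares -/

section Concentration

variable {ι : Type*} [Fintype ι] [IsProbabilityMeasure μ] {ξ : ι → Ω → ℝ} {L : ℝ}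

/-- Both tails at once, the sign of `t` choosing which. The tilt `|t| = ε / m` keeps every `|t a_i|
≤ ε` in the range of the quadratic bound, and makes its second-order error at most `ε / (2m) * a_i`,
linear in `a_i`. -/
theorem measure_le_sum_mul_sq_le_exp (hξ : ∀ i, Measurable (ξ i)) (hind : iIndepFun ξ μ)
    (hL : 0 < L) (h2 : ∀ i, ∫ ω, ξ i ω ^ 2 ∂μ = 2)
    (hexp : ∀ i, ∫⁻ ω, ENNReal.ofReal (Real.exp (ξ i ω ^ 2 / (2 * L ^ 2))) ∂μ ≤ 4)
    {a : ι → ℝ} {m ε : ℝ} (ha : ∀ i, 0 ≤ a i) (ham : ∀ i, a i ≤ m) (hm : 0 < m)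
    (hε0 : 0 ≤ ε) (hε1 : 4 * L ^ 2 * ε ≤ 1) (hε2 : 256 * L ^ 4 * ε ≤ 1) {t : ℝ}
    (ht : |t| = ε / m) (b : ℝ) :
    μ {ω | b ≤ ∑ i, t * (a i * ξ i ω ^ 2)} ≤
      ENNReal.ofReal (Real.exp (2 * t * ∑ i, a i + ε / (2 * m) * ∑ i, a i - b)) := by
  have htm : |t| * m = ε := by rw [ht]; field_simp
  have hc : ∀ i, ∫⁻ ω, ENNReal.ofReal (Real.exp (t * (a i * ξ i ω ^ 2))) ∂μ ≤
      ENNReal.ofReal (Real.exp (2 * t * a i + ε / (2 * m) * a i)) := fun i => by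
    have hta : |t * a i| ≤ ε := by
      rw [abs_mul, abs_of_nonneg (ha i), ← htm]
      exact mul_le_mul_of_nonneg_left (ham i) (abs_nonneg t)
    have hL2 : 0 ≤ 4 * L ^ 2 := by positivity
    have := lintegral_exp_mul_sq_le (hξ i) hL (h2 i) (hexp i) (t := t * a i)
      ((mul_le_mul_of_nonneg_left hta hL2).trans hε1)
    simp only [mul_assoc t] at this
    refine this.trans (ENNReal.ofReal_le_ofReal (Real.exp_le_exp.2 ?_))
    have hsq : (t * a i) ^ 2 = |t * a i| * (|t| * a i) := by
      rw [← sq_abs, sq, abs_mul, abs_of_nonneg (ha i)]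
    have h4 : 128 * L ^ 4 * (t * a i) ^ 2 ≤ ε / (2 * m) * a i := by
      rw [hsq, ht]
      have h5 : (128 * L ^ 4) * |t * a i| ≤ 1 / 2 := by
        have := mul_le_mul_of_nonneg_left hta (show 0 ≤ 128 * L ^ 4 by positivity)
        linarith
      have h6 : 0 ≤ ε / m * a i := mul_nonneg (div_nonneg hε0 hm.le) (ha i)
      calc 128 * L ^ 4 * (|t * a i| * (ε / m * a i))
          = (128 * L ^ 4 * |t * a i|) * (ε / m * a i) := by ring
        _ ≤ 1 / 2 * (ε / m * a i) := mul_le_mul_of_nonneg_right h5 h6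
        _ = ε / (2 * m) * a i := by field_simp
    rw [mul_assoc] at h4
    linarith
  have := measure_le_sum_le_exp (μ := μ) (Y := fun i ω => t * (a i * ξ i ω ^ 2))
    (fun i => by have := hξ i; fun_prop)
    (hind.comp (fun i x => t * (a i * x ^ 2)) fun i => by fun_prop) hc b
  simpa only [Finset.sum_add_distrib, ← Finset.mul_sum] using this

/-- The mean is `2 ∑ a_i`, so the deviation `∑ a_i` gains `ε / m * ∑ a_i` in the exponent, half of
which pays for the second-order error. The upper tail at `3 ∑ a_i` is symmetric. -/
theorem measure_sum_mul_sq_le_sum_le_exp (hξ : ∀ i, Measurable (ξ i)) (hind : iIndepFun ξ μ)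
    (hL : 0 < L) (h2 : ∀ i, ∫ ω, ξ i ω ^ 2 ∂μ = 2)
    (hexp : ∀ i, ∫⁻ ω, ENNReal.ofReal (Real.exp (ξ i ω ^ 2 / (2 * L ^ 2))) ∂μ ≤ 4)
    {a : ι → ℝ} {m ε : ℝ} (ha : ∀ i, 0 ≤ a i) (ham : ∀ i, a i ≤ m) (hm : 0 < m)
    (hε0 : 0 ≤ ε) (hε1 : 4 * L ^ 2 * ε ≤ 1) (hε2 : 256 * L ^ 4 * ε ≤ 1) :
    μ {ω | ∑ i, a i * ξ i ω ^ 2 ≤ ∑ i, a i} ≤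
      ENNReal.ofReal (Real.exp (-(ε * ∑ i, a i) / (2 * m))) := by
  have hεm : 0 ≤ ε / m := div_nonneg hε0 hm.le
  have := measure_le_sum_mul_sq_le_exp hξ hind hL h2 hexp ha ham hm hε0 hε1 hε2
    (t := -(ε / m)) (by rw [abs_neg, abs_of_nonneg hεm]) (-(ε / m) * ∑ i, a i)
  refine (measure_mono fun ω hω => ?_).trans (this.trans_eq ?_)
  · simp only [Set.mem_ofPred_eq] at hω ⊢
    rw [← Finset.mul_sum]
    exact mul_le_mul_of_nonpos_left hω (by linarith)
  · congr 2
    field_simp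
    ring

theorem measure_three_mul_sum_le_sum_mul_sq_le_exp (hξ : ∀ i, Measurable (ξ i))
    (hind : iIndepFun ξ μ) (hL : 0 < L) (h2 : ∀ i, ∫ ω, ξ i ω ^ 2 ∂μ = 2)
    (hexp : ∀ i, ∫⁻ ω, ENNReal.ofReal (Real.exp (ξ i ω ^ 2 / (2 * L ^ 2))) ∂μ ≤ 4)
    {a : ι → ℝ} {m ε : ℝ} (ha : ∀ i, 0 ≤ a i) (ham : ∀ i, a i ≤ m) (hm : 0 < m)
    (hε0 : 0 ≤ ε) (hε1 : 4 * L ^ 2 * ε ≤ 1) (hε2 : 256 * L ^ 4 * ε ≤ 1) :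
    μ {ω | 3 * ∑ i, a i ≤ ∑ i, a i * ξ i ω ^ 2} ≤
      ENNReal.ofReal (Real.exp (-(ε * ∑ i, a i) / (2 * m))) := by
  have hεm : 0 ≤ ε / m := div_nonneg hε0 hm.le
  have := measure_le_sum_mul_sq_le_exp hξ hind hL h2 hexp ha ham hm hε0 hε1 hε2
    (t := ε / m) (abs_of_nonneg hεm) (ε / m * (3 * ∑ i, a i))
  refine (measure_mono fun ω hω => ?_).trans (this.trans_eq ?_)
  · simp only [Set.mem_ofPred_eq] at hω ⊢
    rw [← Finset.mul_sum]
    exact mul_le_mul_of_nonneg_left hω hεm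
  · congr 2
    field_simp
    ring

end Concentration

/-! ### The noise term, conditionally on the positions -/

/-- Conditionally on `W`, the linear form `∑ᵢ Wᵢ σᵢ ζᵢ` is sub-Gaussian, hence rarely as large as
`‖W‖² / 2`, provided that `‖W‖²` is not too small and the conditional variance not too large. -/
theorem measure_sum_sq_le_two_mul_sum_le_exp {ι : Type*} [Fintype ι] [IsProbabilityMeasure μ]
    {W ζ : ι → Ω → ℝ} (hW : ∀ i, Measurable (W i)) (hζ : ∀ i, Measurable (ζ i))
    (hind : IndepFun (fun ω i => W i ω) (fun ω i => ζ i ω) μ) (hζi : iIndepFun ζ μ) {K : ℝ}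
    (hK : 0 < K)
    (hmgf : ∀ i (s : ℝ), ∫⁻ ω, ENNReal.ofReal (Real.exp (s * ζ i ω)) ∂μ ≤
      ENNReal.ofReal (Real.exp (4 * K ^ 2 * s ^ 2)))
    (σ : ι → ℝ) {T A : ℝ} (hT : 0 ≤ T) (hA : 0 < A) :
    μ {ω | T ≤ ∑ i, W i ω ^ 2 ∧ ∑ i, σ i ^ 2 * W i ω ^ 2 ≤ 3 * A ∧
        ∑ i, W i ω ^ 2 ≤ 2 * ∑ i, W i ω * (σ i * ζ i ω)} ≤
      ENNReal.ofReal (Real.exp (-(T ^ 2 / (192 * K ^ 2 * A)))) := by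
  have hWm : Measurable fun ω i => W i ω := measurable_pi_lambda _ hW
  have hζm : Measurable fun ω i => ζ i ω := measurable_pi_lambda _ hζ
  set S : Set ((ι → ℝ) × (ι → ℝ)) := {p | T ≤ ∑ i, p.1 i ^ 2} ∩
    ({p | ∑ i, σ i ^ 2 * p.1 i ^ 2 ≤ 3 * A} ∩
      {p | ∑ i, p.1 i ^ 2 ≤ 2 * ∑ i, p.1 i * (σ i * p.2 i)})
  have hSm : MeasurableSet S :=
    (measurableSet_le (by fun_prop) (by fun_prop)).inter
      ((measurableSet_le (by fun_prop) (by fun_prop)).inter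
        (measurableSet_le (by fun_prop) (by fun_prop)))
  have hprob : IsProbabilityMeasure (μ.map fun ω i => W i ω) :=
    Measure.isProbabilityMeasure_map hWm.aemeasurable
  have hprob' : IsProbabilityMeasure (μ.map fun ω i => ζ i ω) :=
    Measure.isProbabilityMeasure_map hζm.aemeasurable
  have hsection : ∀ x : ι → ℝ, (μ.map fun ω i => ζ i ω) (Prod.mk x ⁻¹' S) ≤
      ENNReal.ofReal (Real.exp (-(T ^ 2 / (192 * K ^ 2 * A)))) := by
    intro x
    by_cases hx : T ≤ ∑ i, x i ^ 2 ∧ ∑ i, σ i ^ 2 * x i ^ 2 ≤ 3 * A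
    · rw [Measure.map_apply hζm (measurable_prodMk_left hSm)]
      -- The minimiser of the Chernoff exponent `12 K² A l² - l T / 2`, with minimum `-T² / (192 K²
      -- A)`.
      set l : ℝ := T / (48 * K ^ 2 * A) with hl
      have hl0 : 0 ≤ l := by positivity
      have := measure_le_sum_le_exp (μ := μ) (Y := fun i ω => (l * (x i * σ i)) * ζ i ω)
        (fun i => by have := hζ i; fun_prop)
        (hζi.comp (fun i y => (l * (x i * σ i)) * y) fun i => by fun_prop)
        (fun i => hmgf i (l * (x i * σ i))) (l * (T / 2))
      refine (measure_mono fun ω hω => ?_).trans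
        (this.trans (ENNReal.ofReal_le_ofReal (Real.exp_le_exp.2 ?_)))
      · have h3 : ∑ i, x i ^ 2 ≤ 2 * ∑ i, x i * (σ i * ζ i ω) := hω.2.2
        have h4 : ∑ i, (l * (x i * σ i)) * ζ i ω = l * ∑ i, x i * (σ i * ζ i ω) := by
          rw [Finset.mul_sum]
          exact Finset.sum_congr rfl fun i _ => by ring
        simp only [Set.mem_ofPred_eq]
        rw [h4]
        exact mul_le_mul_of_nonneg_left (by linarith [hx.1]) hl0
      · have h4 : ∑ i, 4 * K ^ 2 * (l * (x i * σ i)) ^ 2 =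
            4 * K ^ 2 * l ^ 2 * ∑ i, σ i ^ 2 * x i ^ 2 := by
          rw [Finset.mul_sum]
          exact Finset.sum_congr rfl fun i _ => by ring
        have h5 : 4 * K ^ 2 * l ^ 2 * ∑ i, σ i ^ 2 * x i ^ 2 ≤ 4 * K ^ 2 * l ^ 2 * (3 * A) :=
          mul_le_mul_of_nonneg_left hx.2 (by positivity)
        rw [h4]
        refine (sub_le_sub_right h5 _).trans_eq ?_
        rw [hl]
        field_simp
        ring
    -- A value of `W` violating either of the first two constraints has an empty section.
    · have : Prod.mk x ⁻¹' S = ∅ := Set.eq_empty_of_forall_notMem fun y hy => hx ⟨hy.1, hy.2.1⟩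
      simp [this]
  calc μ {ω | T ≤ ∑ i, W i ω ^ 2 ∧ ∑ i, σ i ^ 2 * W i ω ^ 2 ≤ 3 * A ∧
        ∑ i, W i ω ^ 2 ≤ 2 * ∑ i, W i ω * (σ i * ζ i ω)}
      = (μ.map fun ω => ((fun i => W i ω), fun i => ζ i ω)) S :=
        (Measure.map_apply (hWm.prodMk hζm) hSm).symm
    _ = ∫⁻ x, (μ.map fun ω i => ζ i ω) (Prod.mk x ⁻¹' S) ∂(μ.map fun ω i => W i ω) := by
        rw [(indepFun_iff_map_prod_eq_prod_map_map hWm.aemeasurable hζm.aemeasurable).1 hind,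
          Measure.prod_apply hSm]
    _ ≤ ∫⁻ _, ENNReal.ofReal (Real.exp (-(T ^ 2 / (192 * K ^ 2 * A))))
          ∂(μ.map fun ω i => W i ω) := lintegral_mono hsection
    _ = _ := by simp

end

/-! ### Deterministic criterion for exact recovery, and stable ranks -/

/-- If every observation is strictly closer to its own point than to any other point, then the
least sum of squares estimator makes no mistake. -/
theorem IsLSS.eq_of_forall_lt {n d : ℕ}
    {est : (Fin n → EuclideanSpace ℝ (Fin d)) → (Fin n → EuclideanSpace ℝ (Fin d)) →
      Equiv.Perm (Fin n)} (h : IsLSS est) {X Z : Fin n → EuclideanSpace ℝ (Fin d)}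
    (hlt : ∀ i i' j, i ≠ i' →
      2 * ∑ k, (X i k - X i' k) * Z j k < ∑ k, (X i k - X i' k) ^ 2) (π : Equiv.Perm (Fin n)) :
    est X (observedPoints π X Z) = π := by
  set τ := est X (observedPoints π X Z) with hτ
  by_contra hne
  obtain ⟨j₀, hj₀⟩ : ∃ j, τ j ≠ π j := by
    by_contra! hall
    exact hne (Equiv.ext hall)
  -- Expands `‖Δ - Z_j‖²` with `Δ = X (τ j) - X (π j)`, the noise `Z_j` being the residual of the
  -- true match.
  have key : ∀ j, ‖X (τ j) - observedPoints π X Z j‖ ^ 2 = ‖X (π j) - observedPoints π X Z j‖ ^ 2 +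
      (∑ k, (X (τ j) k - X (π j) k) ^ 2 - 2 * ∑ k, (X (τ j) k - X (π j) k) * Z j k) := fun j => by
    simp only [observedPoints, EuclideanSpace.real_norm_sq_eq, PiLp.sub_apply, PiLp.add_apply]
    rw [Finset.mul_sum, ← Finset.sum_sub_distrib, ← Finset.sum_add_distrib]
    exact Finset.sum_congr rfl fun k _ => by ring
  refine absurd (h X (observedPoints π X Z) π) (not_le.2 ?_)
  refine Finset.sum_lt_sum (fun j _ => ?_) ⟨j₀, Finset.mem_univ _, ?_⟩
  · rw [key j]
    by_cases hj : τ j = π j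
    · simp [hj]
    · linarith [hlt _ _ j hj]
  · rw [key j₀]
    linarith [hlt _ _ j₀ hj₀]

/-- The Euclidean operator norm of a diagonal matrix is the sup norm of its diagonal. -/
theorem stableRank_diagonal {d : ℕ} (v : Fin d → ℝ) :
    stableRank (Matrix.diagonal v) = (∑ j, v j) / ‖v‖ := by
  have : ‖Matrix.toEuclideanCLM (𝕜 := ℝ) (n := Fin d) (Matrix.diagonal v)‖ = ‖v‖ :=
    Matrix.l2_opNorm_diagonal v
  rw [stableRank, this, Matrix.trace_diagonal]

/-! ### Error probabilities in the model -/

section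

variable {Ω : Type*} [MeasurableSpace Ω] {μ : Measure Ω} {n d : ℕ}

namespace IsIIDSubGaussian

variable {V : Fin n → Ω → EuclideanSpace ℝ (Fin d)} {K : ℝ}

theorem measurable_coord (h : IsIIDSubGaussian μ V K) (i : Fin n) (k : Fin d) :
    Measurable fun ω => V i ω k := by
  have := h.measurable i
  fun_prop

theorem lintegral_exp_sq_div_le (h : IsIIDSubGaussian μ V K) (hK : 0 < K) (i : Fin n)
    (k : Fin d) : ∫⁻ ω, ENNReal.ofReal (Real.exp (V i ω k ^ 2 / (2 * K) ^ 2)) ∂μ ≤ 2 :=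
  lintegral_exp_sq_div_le_of_subGaussianNorm_le hK (by linarith) (h.subGaussian i k)

theorem lintegral_exp_mul_le [IsProbabilityMeasure μ] (h : IsIIDSubGaussian μ V K) (hK : 0 < K) (i : Fin n) (k : Fin d)
    (s : ℝ) : ∫⁻ ω, ENNReal.ofReal (Real.exp (s * V i ω k)) ∂μ ≤
      ENNReal.ofReal (Real.exp (4 * K ^ 2 * s ^ 2)) := by
  have := lintegral_exp_mul_le_of_mean_zero (h.measurable_coord i k) (by linarith : 0 < 2 * K)
    (h.mean_zero i k) (h.lintegral_exp_sq_div_le hK i k) s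
  rwa [mul_pow, show (2 : ℝ) ^ 2 = 4 by norm_num] at this

theorem indepFun_coord (h : IsIIDSubGaussian μ V K) {i i' : Fin n} (hii : i ≠ i') (k : Fin d) :
    IndepFun (fun ω => V i ω k) (fun ω => V i' ω k) μ := by
  have hk : Measurable fun x : EuclideanSpace ℝ (Fin d) => x k := by fun_prop
  exact (h.indep.indepFun hii).comp hk hk

theorem iIndepFun_sub [IsProbabilityMeasure μ] (h : IsIIDSubGaussian μ V K) {i i' : Fin n} (hii : i ≠ i') :
    iIndepFun (fun (k : Fin d) ω => V i ω k - V i' ω k) μ := by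
  have hk : Measurable fun x : EuclideanSpace ℝ (Fin d) => x.ofLp := by fun_prop
  exact (iIndepFun_prodMk_of_indepFun (h.measurable_coord i) (h.measurable_coord i')
    (h.indep_coord i) (h.indep_coord i') ((h.indep.indepFun hii).comp hk hk)).comp
    (fun _ p => p.1 - p.2) fun _ => by fun_prop

end IsIIDSubGaussian

/-- The probability that an observation with noise `Z_j` is at least as close to `X_i` as to its
own point `X_{i'}`. -/
theorem ModelHD.measure_sum_sq_le_two_mul_sum_le [IsProbabilityMeasure μ] [NeZero d] {σX σZ : Fin d → ℝ}
    {Xt Zt : Fin n → Ω → EuclideanSpace ℝ (Fin d)} {πstar : Ω → Equiv.Perm (Fin n)} {KX KZ : ℝ}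
    (h : ModelHD μ σX σZ Xt Zt πstar KX KZ) (hKX : 0 < KX) (hKZ : 0 < KZ) {ε l m m' : ℝ}
    (hε0 : 0 ≤ ε) (hε1 : 4 * (2 * KX) ^ 2 * ε ≤ 1) (hε2 : 256 * (2 * KX) ^ 4 * ε ≤ 1)
    (hm : ∀ k, σX k ^ 2 ≤ m) (hm' : ∀ k, σZ k ^ 2 * σX k ^ 2 ≤ m')
    (hl : 8 * l * m ≤ ε * ∑ k, σX k ^ 2) (hl' : 8 * l * m' ≤ ε * ∑ k, σZ k ^ 2 * σX k ^ 2)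
    (hsnr : 768 * KZ ^ 2 * l * ∑ k, σZ k ^ 2 * σX k ^ 2 ≤ (∑ k, σX k ^ 2) ^ 2)
    {i i' : Fin n} (hii : i ≠ i') (j : Fin n) :
    μ {ω | ∑ k, (σX k * (Xt i ω k - Xt i' ω k)) ^ 2 ≤
        2 * ∑ k, σX k * (Xt i ω k - Xt i' ω k) * (σZ k * Zt j ω k)} ≤
      ENNReal.ofReal (3 * Real.exp (-(4 * l))) := by
  have hσX : ∀ k, 0 < σX k ^ 2 := fun k => pow_pos (h.σX_pos k) 2
  have hσ : ∀ k, 0 < σZ k ^ 2 * σX k ^ 2 := fun k => mul_pos (pow_pos (h.σZ_pos k) 2) (hσX k)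
  have hm0 : 0 < m := (hσX 0).trans_le (hm 0)
  have hm0' : 0 < m' := (hσ 0).trans_le (hm' 0)
  set T := ∑ k, σX k ^ 2
  set A := ∑ k, σZ k ^ 2 * σX k ^ 2
  have hT : 0 < T := Finset.sum_pos (fun k _ => hσX k) Finset.univ_nonempty
  have hA : 0 < A := Finset.sum_pos (fun k _ => hσ k) Finset.univ_nonempty
  set ξ : Fin d → Ω → ℝ := fun k ω => Xt i ω k - Xt i' ω k with hξdef
  have hX := h.positions
  have hZ := h.perturbations
  have hξ : ∀ k, Measurable (ξ k) := fun k =>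
    (hX.measurable_coord i k).sub (hX.measurable_coord i' k)
  have hξi : iIndepFun ξ μ := hX.iIndepFun_sub hii
  have hξ2 : ∀ k, ∫ ω, ξ k ω ^ 2 ∂μ = 2 := fun k =>
    integral_sub_sq_eq_two (hX.mean_zero i k) (hX.mean_zero i' k) (h.unit_variance i k)
      (h.unit_variance i' k) (hX.measurable_coord i k) (hX.measurable_coord i' k)
      (hX.indepFun_coord hii k)
  have hL : 0 < 2 * KX := by linarith
  have hξexp : ∀ k, ∫⁻ ω, ENNReal.ofReal (Real.exp (ξ k ω ^ 2 / (2 * (2 * KX) ^ 2))) ∂μ ≤ 4 :=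
    fun k => lintegral_exp_sub_sq_le hL (hX.measurable_coord i k) (hX.measurable_coord i' k)
      (hX.indepFun_coord hii k) (hX.lintegral_exp_sq_div_le hKX i k)
      (hX.lintegral_exp_sq_div_le hKX i' k)
  have hlow := measure_sum_mul_sq_le_sum_le_exp hξ hξi hL hξ2 hξexp (fun k => (hσX k).le) hm hm0
    hε0 hε1 hε2
  have hup := measure_three_mul_sum_le_sum_mul_sq_le_exp hξ hξi hL hξ2 hξexp (fun k => (hσ k).le)
    hm' hm0' hε0 hε1 hε2
  have hnoise := measure_sum_sq_le_two_mul_sum_le_exp (μ := μ) (W := fun k ω => σX k * ξ k ω)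
    (ζ := fun k ω => Zt j ω k) (fun k => (hξ k).const_mul _) (hZ.measurable_coord j)
    (h.indep_positions_perturbations.comp
      (φ := fun x : Fin n → EuclideanSpace ℝ (Fin d) => fun k => σX k * (x i k - x i' k))
      (ψ := fun z : Fin n → EuclideanSpace ℝ (Fin d) => fun k => z j k)
      (by fun_prop) (by fun_prop))
    (hZ.indep_coord j) hKZ (hZ.lintegral_exp_mul_le hKZ j) σZ hT.le hA
  -- All three exponents are at least `4l`: the factor 8 in `hl` and `hl'` is `2 · 4`, and 768 in
  -- `hsnr` is `4 · 192`.
  have hexp : ∀ x : ℝ, 4 * l ≤ x →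
      ENNReal.ofReal (Real.exp (-x)) ≤ ENNReal.ofReal (Real.exp (-(4 * l))) := fun x hx =>
    ENNReal.ofReal_le_ofReal (Real.exp_le_exp.2 (neg_le_neg hx))
  rw [neg_div] at hlow hup
  have hlow' := hlow.trans (hexp _ (by rw [le_div_iff₀ (by positivity)]; linarith))
  have hup' := hup.trans (hexp _ (by rw [le_div_iff₀ (by positivity)]; linarith))
  have hnoise' := hnoise.trans (hexp _ (by rw [le_div_iff₀ (by positivity)]; linarith))
  have hsub : {ω | ∑ k, (σX k * (Xt i ω k - Xt i' ω k)) ^ 2 ≤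
        2 * ∑ k, σX k * (Xt i ω k - Xt i' ω k) * (σZ k * Zt j ω k)} ⊆
      ({ω | ∑ k, σX k ^ 2 * ξ k ω ^ 2 ≤ T} ∪ {ω | 3 * A ≤ ∑ k, σZ k ^ 2 * σX k ^ 2 * ξ k ω ^ 2}) ∪
      {ω | T ≤ ∑ k, (σX k * ξ k ω) ^ 2 ∧ ∑ k, σZ k ^ 2 * (σX k * ξ k ω) ^ 2 ≤ 3 * A ∧
        ∑ k, (σX k * ξ k ω) ^ 2 ≤ 2 * ∑ k, σX k * ξ k ω * (σZ k * Zt j ω k)} := by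
    intro ω hω
    by_cases h1 : ∑ k, σX k ^ 2 * ξ k ω ^ 2 ≤ T
    · exact Or.inl (Or.inl h1)
    by_cases h2 : 3 * A ≤ ∑ k, σZ k ^ 2 * σX k ^ 2 * ξ k ω ^ 2
    · exact Or.inl (Or.inr h2)
    refine Or.inr ⟨?_, ?_, hω⟩
    · simp only [mul_pow]
      exact (not_le.1 h1).le
    · simp only [mul_pow, ← mul_assoc]
      exact (not_le.1 h2).le
  calc _ ≤ _ := measure_mono hsub
    _ ≤ _ := (measure_union_le _ _).trans (add_le_add_left (measure_union_le _ _) _)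
    _ ≤ ENNReal.ofReal (Real.exp (-(4 * l))) + ENNReal.ofReal (Real.exp (-(4 * l))) +
        ENNReal.ofReal (Real.exp (-(4 * l))) := add_le_add (add_le_add hlow' hup') hnoise'
    _ = ENNReal.ofReal (3 * Real.exp (-(4 * l))) := by
        have := (Real.exp_pos (-(4 * l))).le
        rw [← ENNReal.ofReal_add this this, ← ENNReal.ofReal_add (by positivity) this]
        congr 1
        ring

/-- Letting the noise index `j` range freely, instead of tying it to `i'` by the hidden matching,
gives covering events that do not involve `πstar`. The price is `n³` events instead of `n²`. -/
theorem ModelHD.measure_hammingDist_ne_zero_le [IsProbabilityMeasure μ] [NeZero d] {σX σZ : Fin d → ℝ}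
    {Xt Zt : Fin n → Ω → EuclideanSpace ℝ (Fin d)} {πstar : Ω → Equiv.Perm (Fin n)} {KX KZ : ℝ}
    (h : ModelHD μ σX σZ Xt Zt πstar KX KZ) (hKX : 0 < KX) (hKZ : 0 < KZ) {ε l m m' : ℝ}
    (hε0 : 0 ≤ ε) (hε1 : 4 * (2 * KX) ^ 2 * ε ≤ 1) (hε2 : 256 * (2 * KX) ^ 4 * ε ≤ 1)
    (hm : ∀ k, σX k ^ 2 ≤ m) (hm' : ∀ k, σZ k ^ 2 * σX k ^ 2 ≤ m')
    (hl : 8 * l * m ≤ ε * ∑ k, σX k ^ 2) (hl' : 8 * l * m' ≤ ε * ∑ k, σZ k ^ 2 * σX k ^ 2)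
    (hsnr : 768 * KZ ^ 2 * l * ∑ k, σZ k ^ 2 * σX k ^ 2 ≤ (∑ k, σX k ^ 2) ^ 2)
    {est : (Fin n → EuclideanSpace ℝ (Fin d)) → (Fin n → EuclideanSpace ℝ (Fin d)) →
      Equiv.Perm (Fin n)} (hest : IsLSS est) :
    μ {ω | hammingDist (est (scaledPoints σX fun i => Xt i ω)
      (observedPoints (πstar ω) (scaledPoints σX fun i => Xt i ω)
        (scaledPoints σZ fun i => Zt i ω))) (πstar ω) = 0}ᶜ ≤
      ENNReal.ofReal (n ^ 3 * (3 * Real.exp (-(4 * l)))) := by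
  set B : Fin n × Fin n × Fin n → Set Ω := fun p => {ω | p.1 ≠ p.2.1 ∧
    ∑ k, (σX k * (Xt p.1 ω k - Xt p.2.1 ω k)) ^ 2 ≤
        2 * ∑ k, σX k * (Xt p.1 ω k - Xt p.2.1 ω k) * (σZ k * Zt p.2.2 ω k)}
  have hsub : {ω | hammingDist (est (scaledPoints σX fun i => Xt i ω)
      (observedPoints (πstar ω) (scaledPoints σX fun i => Xt i ω)
        (scaledPoints σZ fun i => Zt i ω))) (πstar ω) = 0}ᶜ ⊆ ⋃ p, B p := by
    intro ω hω
    by_contra hn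
    refine hω ?_
    simp only [Set.mem_ofPred_eq, hammingDist_eq_zero]
    congr 1
    refine hest.eq_of_forall_lt (fun i i' j hii => ?_) _
    by_contra hle
    refine hn (Set.mem_iUnion.2 ⟨(i, i', j), hii, ?_⟩)
    simpa [scaledPoints, covSqrt, Matrix.mulVec_diagonal, mul_sub] using hle
  have hB : ∀ p, μ (B p) ≤ ENNReal.ofReal (3 * Real.exp (-(4 * l))) := by
    rintro ⟨i, i', j⟩
    by_cases hii : i = i'
    · have : B (i, i', j) = ∅ := Set.eq_empty_of_forall_notMem fun ω hω => hω.1 hii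
      simp [this]
    · exact (measure_mono fun ω hω => hω.2).trans (h.measure_sum_sq_le_two_mul_sum_le hKX hKZ
        hε0 hε1 hε2 hm hm' hl hl' hsnr hii j)
  calc _ ≤ μ (⋃ p, B p) := measure_mono hsub
    _ ≤ ∑ p, μ (B p) := measure_iUnion_fintype_le _ _
    _ ≤ ∑ _p : Fin n × Fin n × Fin n, ENNReal.ofReal (3 * Real.exp (-(4 * l))) :=
        Finset.sum_le_sum fun p _ => hB p
    _ = ENNReal.ofReal (n ^ 3 * (3 * Real.exp (-(4 * l)))) := by
        rw [Finset.sum_const, Finset.card_univ, Fintype.card_prod, Fintype.card_prod,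
          Fintype.card_fin, ENNReal.ofReal_mul (p := (n : ℝ) ^ 3) (by positivity), nsmul_eq_mul,
          ENNReal.ofReal_pow (by positivity), ENNReal.ofReal_natCast]
        push_cast
        ring

end

/-! ### Asymptotics -/

theorem theorem1p4 :
    ∃ bHD : ℝ, 0 < bHD ∧
      ∀ (KX KZ : ℝ) (_ : 0 < KX) (_ : 0 < KZ) (d : ℕ → ℕ)
        (Ω : ℕ → Type*) [∀ n, MeasurableSpace (Ω n)]
        (μ : ∀ n, Measure (Ω n)) [∀ n, IsProbabilityMeasure (μ n)]
        (σX σZ : ∀ n, Fin (d n) → ℝ)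
        (Xt Zt : ∀ n, Fin n → Ω n → EuclideanSpace ℝ (Fin (d n)))
        (πstar : ∀ n, Ω n → Equiv.Perm (Fin n))
        (lss : ∀ n, (Fin n → EuclideanSpace ℝ (Fin (d n))) →
          (Fin n → EuclideanSpace ℝ (Fin (d n))) → Equiv.Perm (Fin n)),
        -- `d = ω(log n)` and the model for each `n`
        (fun n : ℕ => Real.log n) =o[atTop] (fun n : ℕ => (d n : ℝ)) →
        (∀ n, ModelHD (μ n) (σX n) (σZ n) (Xt n) (Zt n) (πstar n) KX KZ) →
        (∀ n, IsLSS (lss n)) →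
        -- both stable ranks are `ω(log n)`
        (fun n : ℕ => Real.log n) =o[atTop]
          (fun n : ℕ => stableRank (covMatrix (σZ n) * covMatrix (σX n))) →
        (fun n : ℕ => Real.log n) =o[atTop] (fun n : ℕ => stableRank (covMatrix (σX n))) →
        -- the signal-to-noise condition
        (∀ᶠ n : ℕ in atTop,
          bHD * KZ ^ 2 ≤ (Real.log n)⁻¹ *
            ((∑ j, σX n j ^ 2) / ∑ j, normalizedVar (σX n) j * σZ n j ^ 2)) →
        WithHighProbability μ (fun n =>
          {ω | hammingDist
            (lss n (scaledPoints (σX n) fun i => Xt n i ω)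
              (observedPoints (πstar n ω) (scaledPoints (σX n) fun i => Xt n i ω)
                (scaledPoints (σZ n) fun i => Zt n i ω)))
            (πstar n ω) = 0}) := by
  -- `768 = 4 · 192` makes each failure probability `O(n⁻⁴)`, enough to beat `n³` triples.
  refine ⟨768, by norm_num, ?_⟩
  intro KX KZ hKX hKZ d Ω _ μ _ σX σZ Xt Zt πstar lss hd hmodel hlss hrZX hrX hsnr
  -- `ε` depends on `KX` alone. The stable ranks exceed every fixed multiple of `log n`, so they
  -- absorb `8 / ε`, and the constant 768 stays free of `KX`.
  set ε : ℝ := min (1 / (4 * (2 * KX) ^ 2)) (1 / (256 * (2 * KX) ^ 4)) with hε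
  have hε0 : 0 < ε := by positivity
  have hε1 : 4 * (2 * KX) ^ 2 * ε ≤ 1 := by
    have := min_le_left (1 / (4 * (2 * KX) ^ 2)) (1 / (256 * (2 * KX) ^ 4))
    rwa [← hε, le_div_iff₀' (by positivity)] at this
  have hε2 : 256 * (2 * KX) ^ 4 * ε ≤ 1 := by
    have := min_le_right (1 / (4 * (2 * KX) ^ 2)) (1 / (256 * (2 * KX) ^ 4))
    rwa [← hε, le_div_iff₀' (by positivity)] at this
  have hbound : ∀ᶠ n : ℕ in atTop, μ n
      {ω | hammingDist
        (lss n (scaledPoints (σX n) fun i => Xt n i ω)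
          (observedPoints (πstar n ω) (scaledPoints (σX n) fun i => Xt n i ω)
            (scaledPoints (σZ n) fun i => Zt n i ω)))
        (πstar n ω) = 0}ᶜ ≤ ENNReal.ofReal (3 / n) := by
    filter_upwards [hd.def one_pos, hrZX.def (show 0 < ε / 8 by positivity),
      hrX.def (show 0 < ε / 8 by positivity), hsnr, eventually_ge_atTop 2] with n hdn hZXn hXn hsn
      hn
    have hn0 : (0 : ℝ) < n := by positivity
    have hlog : 0 < Real.log n := Real.log_pos (by exact_mod_cast hn)
    -- Dimension zero would give `log n ≤ 0`, impossible for `n ≥ 2`.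
    have : NeZero (d n) := ⟨fun h0 => by
      rw [h0] at hdn
      simp only [CharP.cast_eq_zero, norm_zero, mul_zero, norm_le_zero_iff] at hdn
      exact hlog.ne' hdn⟩
    have hM := hmodel n
    have hσX : ∀ k, 0 < σX n k ^ 2 := fun k => pow_pos (hM.σX_pos k) 2
    have hσ : ∀ k, 0 < σZ n k ^ 2 * σX n k ^ 2 := fun k =>
      mul_pos (pow_pos (hM.σZ_pos k) 2) (hσX k)
    have hrank : ∀ v : Fin (d n) → ℝ, (∀ k, 0 < v k) →
        ‖Real.log n‖ ≤ ε / 8 * ‖stableRank (Matrix.diagonal v)‖ →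
        (∀ k, v k ≤ ‖v‖) ∧ 8 * Real.log n * ‖v‖ ≤ ε * ∑ k, v k := fun v hv hle => by
      have hvn : ∀ k, v k ≤ ‖v‖ := fun k => (le_abs_self _).trans (norm_le_pi_norm v k)
      have hpos : 0 < ‖v‖ := (hv 0).trans_le (hvn 0)
      refine ⟨hvn, ?_⟩
      rw [stableRank_diagonal, Real.norm_of_nonneg hlog.le, Real.norm_of_nonneg
        (div_nonneg (Finset.sum_nonneg fun k _ => (hv k).le) hpos.le), ← mul_div_assoc,
        le_div_iff₀ hpos] at hle
      linarith
    obtain ⟨hmX, hlX⟩ := hrank _ hσX hXn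
    rw [covMatrix, covMatrix, Matrix.diagonal_mul_diagonal] at hZXn
    obtain ⟨hmZ, hlZ⟩ := hrank _ hσ hZXn
    have hT : 0 < ∑ k, σX n k ^ 2 := Finset.sum_pos (fun k _ => hσX k) Finset.univ_nonempty
    have hA : 0 < ∑ k, σZ n k ^ 2 * σX n k ^ 2 :=
      Finset.sum_pos (fun k _ => hσ k) Finset.univ_nonempty
    have hden : ∑ j, normalizedVar (σX n) j * σZ n j ^ 2 =
        (∑ k, σZ n k ^ 2 * σX n k ^ 2) / ∑ k, σX n k ^ 2 := by
      rw [Finset.sum_div]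
      exact Finset.sum_congr rfl fun k _ => by rw [normalizedVar]; ring
    -- Clearing denominators gives `768 KZ² log n · A ≤ T²`, that is, `hsnr` with `l = log n`.
    rw [hden, div_div_eq_mul_div, inv_mul_eq_div, le_div_iff₀ hlog, le_div_iff₀ hA, ← sq] at hsn
    refine (hM.measure_hammingDist_ne_zero_le hKX hKZ hε0.le hε1 hε2 hmX hmZ hlX hlZ hsn
      (hlss n)).trans_eq ?_
    congr 1
    -- `n³ · 3 exp(-4 log n) = 3 / n`.
    rw [← mul_neg, mul_comm 4, Real.exp_mul, Real.exp_neg, Real.exp_log hn0,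
      show (4 : ℝ) = ((4 : ℕ) : ℝ) by norm_num, Real.rpow_natCast]
    field_simp
  have hlim : Tendsto (fun n : ℕ => ENNReal.ofReal (3 / n)) atTop (𝓝 0) := by
    simpa using ENNReal.tendsto_ofReal (tendsto_const_div_atTop_nhds_zero_nat (3 : ℝ))
  exact tendsto_of_tendsto_of_tendsto_of_le_of_le' tendsto_const_nhds hlim
    (Eventually.of_forall fun _ => zero_le) hbound
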